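/- Let $d\ge 1$, let $\mu$ be a Borel probability measure on $\mathbb{R}^d$ and let $f(x)=w^Tx+b$ with $w\in\mathbb{R}^d$, $b\in\mathbb{R}$. For $\eta\ge 0$ let $\eta\mathbb{S}$ be the uniform probability measure on the sphere of radius $\eta$ centred at $0$ in $\mathbb{R}^d$. For $x\in\mathbb{R}^d$ and $\epsilon\in[0,1]$ put, with values in $[0,\infty]$, $$\Delta_{\mathrm{adv}}(x;f)=\inf\{\|r\|_2 : r\in\mathbb{R}^d,\ f(x)f(x+r)\le 0\},\qquad \Delta_{\mathrm{unif},\epsilon}(x;f)=\sup\{\eta\ge 0 : \mathbb{P}_{n\sim\eta\mathbb{S}}(f(x)f(x+n)\le 0)\le\epsilon\}$$ (where $\inf\emptyset=\infty$, $\sup\emptyset=0$), and $$\rho_{\mathrm{adv}}(f)=\mathbb{E}_{x\sim\mu}\,\Delta_{\mathrm{adv}}(x;f),\qquad \rho_{\mathrm{unif},\epsilon}(f)=\mathbb{E}_{x\sim\mu}\,\Delta_{\mathrm{unif},\epsilon}(x;f).$$ Then for every $\epsilon\in[0,1/12)$ the functions $\Delta_{\mathrm{adv}}(\cdot\,;f)$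 and $\Delta_{\mathrm{unif},\epsilon}(\cdot\,;f)$ are measurable, and $$\max\bigl(C_1(\epsilon)\sqrt d,\,1\bigr)\,\rho_{\mathrm{adv}}(f)\ \le\ \rho_{\mathrm{unif},\epsilon}(f)\ \le\ \widetilde{C_2}(\epsilon,d)\,\rho_{\mathrm{adv}}(f)\ \le\ C_2(\epsilon)\sqrt d\,\rho_{\mathrm{adv}}(f),$$ where $C_1(\epsilon)=(2\ln(2/\epsilon))^{-1/2}$ for $\epsilon>0$ and $C_1(0)=0$, $\widetilde{C_2}(\epsilon,d)=(1-(12\epsilon)^{1/d})^{-1/2}$ and $C_2(\epsilon)=(1-12\epsilon)^{-1/2}$. Moreover, if $w\ne 0$ and $\mu$ has bounded support (that is, $\mu(\{x:\|x\|_2\le M\})=1$ for some $M$), then $\rho_{\mathrm{adv}}(f)$ and $\rho_{\mathrm{unif},\epsilon}(f)$ are finite. -/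

import Mathlib

open MeasureTheory
open scoped ENNReal NNReal

namespace Robustness

noncomputable section

/-- The linear classification function `f(x) = wᵀ x + b` on `ℝ^d`. -/
def linearClassifier {d : ℕ} (w : EuclideanSpace ℝ (Fin d)) (b : ℝ) :
    EuclideanSpace ℝ (Fin d) → ℝ :=
  fun x => inner ℝ w x + b

/-- The uniform probability measure on the sphere of radius `η` centred at `0` in `ℝ^d`:
the normalized surface measure of the unit sphere, pushed forward by `n ↦ η n`
(for `η = 0` it is the Dirac mass at `0`). -/
def uniformSphere (d : ℕ) (η : ℝ≥0) : Measure (EuclideanSpace ℝ (Fin d)) :=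
  ((((volume : Measure (EuclideanSpace ℝ (Fin d))).toSphere Set.univ)⁻¹ •
      (volume : Measure (EuclideanSpace ℝ (Fin d))).toSphere)).map
    (fun n : Metric.sphere (0 : EuclideanSpace ℝ (Fin d)) 1 =>
      (η : ℝ) • (n : EuclideanSpace ℝ (Fin d)))

/-- The norm of the smallest perturbation `r` with `f(x) f(x + r) ≤ 0`, as an element of `[0, ∞]`
(it is `∞` if there is no such perturbation). -/
def deltaAdv {d : ℕ} (f : EuclideanSpace ℝ (Fin d) → ℝ) (x : EuclideanSpace ℝ (Fin d)) : ℝ≥0∞ :=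
  ⨅ (r : EuclideanSpace ℝ (Fin d)) (_ : f x * f (x + r) ≤ 0), ‖r‖ₑ

/-- The largest radius `η ≥ 0` such that noise `n` drawn uniformly from the sphere of radius `η`
satisfies `f(x) f(x + n) ≤ 0` with probability at most `ε`, as a supremum in `[0, ∞]`
(it is `0` if no radius qualifies, which happens when `f(x) = 0` and `ε < 1`). -/
def deltaUnif {d : ℕ} (ε : ℝ) (f : EuclideanSpace ℝ (Fin d) → ℝ)
    (x : EuclideanSpace ℝ (Fin d)) : ℝ≥0∞ :=
  ⨆ (η : ℝ≥0) (_ : uniformSphere d η {n | f x * f (x + n) ≤ 0} ≤ ENNReal.ofReal ε), (η : ℝ≥0∞)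

/-- Robustness to adversarial perturbations: the `μ`-expectation of `deltaAdv f`. -/
def rhoAdv {d : ℕ} (μ : Measure (EuclideanSpace ℝ (Fin d)))
    (f : EuclideanSpace ℝ (Fin d) → ℝ) : ℝ≥0∞ :=
  ∫⁻ x, deltaAdv f x ∂μ

/-- `ε`-robustness to random uniform noise: the `μ`-expectation of `deltaUnif ε f`. -/
def rhoUnif {d : ℕ} (μ : Measure (EuclideanSpace ℝ (Fin d))) (ε : ℝ)
    (f : EuclideanSpace ℝ (Fin d) → ℝ) : ℝ≥0∞ :=
  ∫⁻ x, deltaUnif ε f x ∂μ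

/-- `C₁(ε) = (2 ln(2/ε))^{-1/2}`, with its limit value `0` at `ε = 0`. -/
def C₁ (ε : ℝ) : ℝ := if ε = 0 then 0 else (2 * Real.log (2 / ε)) ^ (-(1 / 2) : ℝ)

/-- `(1 - (12 ε)^{1/d})^{-1/2}`. -/
def C₂tilde (ε : ℝ) (d : ℕ) : ℝ := (1 - (12 * ε) ^ (1 / (d : ℝ))) ^ (-(1 / 2) : ℝ)

/-- `C₂(ε) = (1 - 12 ε)^{-1/2}`. -/
def C₂ (ε : ℝ) : ℝ := (1 - 12 * ε) ^ (-(1 / 2) : ℝ)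

end

end Robustness

/-! The comparison is pointwise in `x` and then integrated. For `w ≠ 0`, put `c = |f x| / ‖w‖`, the
distance from `x` to the hyperplane `f = 0`; this is `deltaAdv`. When `f x ≠ 0`, noise of norm `η >
0` flips the decision exactly on a spherical cap of relative height `t = c / η`. In polar
coordinates its probability is the share of the unit ball occupied by `sector u t`, so everything
reduces to two volume bounds for sectors.

The sector lies in a ball of radius at most `exp (-t² / 2)`, so its share is at most `exp (-d t² /
2)` (`measure_sector_le`). It also contains half of an ellipsoid, so its share is at least `(1 - t²)
^ d / 12` (`le_measure_sector`). Solving each bound for `η` gives `C₁` and `C₂tilde`; the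
alternative constant `1` holds because a sphere of radius below `c` misses the hyperplane, and
Bernoulli's inequality gives `C₂tilde ≤ C₂ √d`. Where `f x = 0` both radii vanish; where `w = 0` and
`b ≠ 0` both are infinite. -/

namespace Robustness

/-! ### Elementary inequalities behind the constants. -/

section Numeric

lemma one_third_le_pow (d : ℕ) (hd : 1 ≤ d) : (1 / 3 : ℝ) ≤ ((d : ℝ) / (d + 1)) ^ d := by
  have hd' : (0 : ℝ) < d := by exact_mod_cast hd
  have h1 : (1 + 1 / (d : ℝ)) ^ d ≤ 3 := by
    calc (1 + 1 / (d : ℝ)) ^ d ≤ (Real.exp (1 / d)) ^ d := by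
          gcongr
          linarith [Real.add_one_le_exp (1 / (d : ℝ))]
      _ = Real.exp 1 := by rw [← Real.exp_nat_mul]; congr 1; field_simp
      _ ≤ 3 := by linarith [Real.exp_one_lt_d9]
  have h2 : ((d : ℝ) / (d + 1)) ^ d = 1 / (1 + 1 / (d : ℝ)) ^ d := by
    rw [← one_div_pow]
    congr 1
    field_simp
  rw [h2]
  exact one_div_le_one_div_of_le (by positivity) h1

/-- Each of the `m + 1` terms of the geometric sum up to `q ^ m` is at least `q ^ m`, and the sum
times `1 - q` is `1 - q ^ (m + 1)`. -/
lemma pow_mul_one_sub_le (m : ℕ) {q : ℝ} (h0 : 0 ≤ q) (h1 : q ≤ 1) :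
    ((m : ℝ) + 1) * (q ^ m * (1 - q)) ≤ 1 := by
  have h2 : ((m : ℝ) + 1) * q ^ m ≤ ∑ i ∈ Finset.range (m + 1), q ^ i := by
    calc ((m : ℝ) + 1) * q ^ m = ∑ i ∈ Finset.range (m + 1), q ^ m := by simp
      _ ≤ _ := Finset.sum_le_sum fun i hi =>
        pow_le_pow_of_le_one h0 h1 (by simpa [Nat.lt_succ_iff] using hi)
  have h3 := mul_neg_geom_sum q (m + 1)
  have h4 : 0 ≤ q ^ (m + 1) := by positivity
  nlinarith [mul_le_mul_of_nonneg_right h2 (sub_nonneg.2 h1)]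

/-- The volume estimate behind the inscribed half-ellipsoid in a spherical sector. -/
lemma pow_mul_one_sub_mul_le (d : ℕ) (hd : 1 ≤ d) {q : ℝ} (h0 : 0 ≤ q) (h1 : q ≤ 1) :
    q ^ d * (1 - (d : ℝ) / (d + 1) * q)
      ≤ 36 * (((d : ℝ) / (d + 1)) ^ d * (1 - (d : ℝ) / (d + 1)) * q) := by
  have hg := one_third_le_pow d hd
  obtain ⟨m, rfl⟩ : ∃ m, d = m + 1 := ⟨d - 1, by omega⟩
  have hk := pow_mul_one_sub_le m h0 h1
  have hq : q ^ m ≤ 1 := pow_le_one₀ h0 h1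
  have hm : (0 : ℝ) ≤ m := by positivity
  set G := (((m + 1 : ℕ) : ℝ) / ((m + 1 : ℕ) + 1)) ^ (m + 1)
  have e1 : (1 : ℝ) - ((m + 1 : ℕ) : ℝ) / ((m + 1 : ℕ) + 1) = 1 / (m + 2) := by
    push_cast; field_simp; ring
  have e2 : 1 - ((m + 1 : ℕ) : ℝ) / ((m + 1 : ℕ) + 1) * q = ((m + 2) * (1 - q) + q) / (m + 2) := by
    push_cast; field_simp; ring
  rw [e1, e2, pow_succ]
  -- The left side is at most `1 + 1 + 1`, while `G ≥ 1 / 3` makes the right side at least `12`.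
  have key : q ^ m * ((m + 2) * (1 - q) + q) ≤ 36 * G := by
    have : q ^ m * (1 - q) ≤ 1 := by
      have : 0 ≤ q ^ m * (1 - q) := mul_nonneg (by positivity) (by linarith)
      nlinarith
    have : q ^ m * q ≤ 1 := mul_le_one₀ hq h0 h1
    nlinarith
  have : q ^ m * q * (((m + 2) * (1 - q) + q) / (m + 2))
      = (q ^ m * ((m + 2) * (1 - q) + q)) * (q / (m + 2)) := by ring
  rw [this]
  have : 36 * (G * (1 / ((m : ℝ) + 2)) * q) = (36 * G) * (q / (m + 2)) := by ring
  rw [this]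
  gcongr

lemma inv_four_mul_le_exp_neg {s : ℝ} (h0 : 1 / 2 ≤ s) (h1 : s ≤ 1) :
    1 / (4 * s) ≤ Real.exp (-s) := by
  have h2 : Real.exp (-s) = Real.exp (1 - s) / Real.exp 1 := by
    rw [← Real.exp_sub]; congr 1; ring
  have h3 := Real.add_one_le_exp (1 - s)
  rw [h2, div_le_div_iff₀ (by linarith) (Real.exp_pos 1)]
  nlinarith [Real.exp_one_lt_d9]

end Numeric

/-! ### Volume of the sectors of the unit ball. -/

section Sector

variable {E : Type*} [NormedAddCommGroup E] [InnerProductSpace ℝ E]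

/-- The part of the punctured open unit ball lying in the cone `t ‖x‖ ≤ ⟪u, x⟫`. -/
def sector (u : E) (t : ℝ) : Set E := {x | x ≠ 0 ∧ ‖x‖ < 1 ∧ t * ‖x‖ ≤ inner ℝ u x}

lemma sector_antitone (u : E) : Antitone (sector u) := by
  rintro s t hst x ⟨h0, h1, h2⟩
  exact ⟨h0, h1, le_trans (by gcongr) h2⟩

lemma sector_eq_empty {u : E} (hu : ‖u‖ = 1) {t : ℝ} (ht : 1 < t) : sector u t = ∅ := by
  ext x
  simp only [sector, Set.mem_ofPred_eq, Set.mem_empty_iff_false, iff_false]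
  rintro ⟨h0, -, h2⟩
  have h3 := real_inner_le_norm u x
  have h4 := norm_pos_iff.2 h0
  rw [hu] at h3
  nlinarith

lemma norm_sub_smul_sq {u : E} (hu : ‖u‖ = 1) (c : ℝ) (x : E) :
    ‖x - c • u‖ ^ 2 = ‖x‖ ^ 2 - 2 * c * inner ℝ u x + c ^ 2 := by
  rw [norm_sub_sq_real, real_inner_smul_right, norm_smul, hu, real_inner_comm]
  simp; ring

lemma sector_subset_closedBall_of_sq_le {u : E} (hu : ‖u‖ = 1) {t : ℝ} (h0 : 0 ≤ t)
    (h1 : t ^ 2 ≤ 1 / 2) : sector u t ⊆ Metric.closedBall (t • u) (√(1 - t ^ 2)) := by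
  rintro x ⟨-, hx, h2⟩
  rw [mem_closedBall_iff_norm]
  refine Real.le_sqrt_of_sq_le ?_
  rw [norm_sub_smul_sq hu]
  have := norm_nonneg x
  nlinarith [mul_le_mul_of_nonneg_left h2 h0, mul_nonneg this (sub_nonneg.2 hx.le)]

lemma sector_subset_closedBall_of_pos {u : E} (hu : ‖u‖ = 1) {t : ℝ} (h0 : 0 < t) :
    sector u t ⊆ Metric.closedBall ((1 / (2 * t)) • u) (1 / (2 * t)) := by
  rintro x ⟨-, hx, h2⟩
  rw [mem_closedBall_iff_norm]
  refine le_of_sq_le_sq ?_ (by positivity)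
  rw [norm_sub_smul_sq hu]
  have := norm_nonneg x
  have h3 : ‖x‖ ≤ 2 * (1 / (2 * t)) * inner ℝ u x := by
    have : 2 * (1 / (2 * t)) * inner ℝ u x = inner ℝ u x / t := by field_simp
    rw [this, le_div_iff₀ h0]; linarith
  nlinarith

/-- The linear map scaling by `β` along the unit vector `u` and by `α` on its complement. -/
noncomputable def stretch (u : E) (α β : ℝ) : E →ₗ[ℝ] E :=
  α • LinearMap.transvection (((β - α) / α) • (innerₛₗ ℝ u)) u

lemma stretch_apply (u : E) {α : ℝ} (hα : α ≠ 0) (β : ℝ) (x : E) :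
    stretch u α β x = α • x + ((β - α) * inner ℝ u x) • u := by
  simp only [stretch, LinearMap.smul_apply, LinearMap.transvection.apply, smul_add, smul_smul,
    innerₛₗ_apply_apply, smul_eq_mul]
  congr 2
  field_simp

lemma inner_stretch {u : E} (hu : ‖u‖ = 1) {α : ℝ} (hα : α ≠ 0) (β : ℝ) (x : E) :
    inner ℝ u (stretch u α β x) = β * inner ℝ u x := by
  rw [stretch_apply u hα, inner_add_right, real_inner_smul_right, real_inner_smul_right,
    real_inner_self_eq_norm_sq, hu]
  ring

lemma norm_smul_add_stretch_sq {u : E} (hu : ‖u‖ = 1) {α : ℝ} (hα : α ≠ 0) (β t : ℝ) (x : E) :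
    ‖t • u + stretch u α β x‖ ^ 2
      = (t + β * inner ℝ u x) ^ 2 + α ^ 2 * (‖x‖ ^ 2 - inner ℝ u x ^ 2) := by
  have e : t • u + stretch u α β x = α • x - (-(t + (β - α) * inner ℝ u x)) • u := by
    rw [stretch_apply u hα]; module
  rw [e, norm_sub_smul_sq hu, norm_smul, real_inner_smul_right, mul_pow, Real.norm_eq_abs, sq_abs]
  ring

variable [FiniteDimensional ℝ E]

lemma det_stretch {u : E} (hu : ‖u‖ = 1) {α : ℝ} (hα : α ≠ 0) (β : ℝ) :
    LinearMap.det (stretch u α β) = α ^ Module.finrank ℝ E * (β / α) := by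
  rw [stretch, LinearMap.det_smul, LinearMap.transvection.det]
  simp only [LinearMap.smul_apply, innerₛₗ_apply_apply, real_inner_self_eq_norm_sq, hu, smul_eq_mul]
  rw [one_pow, mul_one, sub_div, div_self hα, add_sub_cancel]

variable [MeasurableSpace E] [BorelSpace E] (ν : Measure E) [ν.IsAddHaarMeasure]

/-- The covering ball is centred at `t • u` while `t² ≤ 1 / 2`; beyond that, the ball of radius `1 /
(2 t)` with `0` on its boundary is used. Both squared radii are at most `exp (-t²)`. -/
lemma measure_sector_le {u : E} (hu : ‖u‖ = 1) {t : ℝ} (h0 : 0 ≤ t) (h1 : t ≤ 1) :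
    ν (sector u t) ≤
      ENNReal.ofReal (Real.exp (-(Module.finrank ℝ E * t ^ 2 / 2))) * ν (Metric.ball 0 1) := by
  suffices ∃ (c : E) (r : ℝ), 0 ≤ r ∧ r ^ 2 ≤ Real.exp (-t ^ 2) ∧
      sector u t ⊆ Metric.closedBall c r by
    obtain ⟨c, r, hr, hre, hs⟩ := this
    refine (measure_mono hs).trans ?_
    rw [Measure.addHaar_closedBall ν c hr]
    gcongr
    have h2 : r ≤ Real.exp (-(t ^ 2 / 2)) := by
      refine le_of_sq_le_sq ?_ (Real.exp_pos _).le
      have e : ((2 : ℕ) : ℝ) * -(t ^ 2 / 2) = -t ^ 2 := by push_cast; ring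
      rwa [← Real.exp_nat_mul, e]
    calc r ^ Module.finrank ℝ E ≤ Real.exp (-(t ^ 2 / 2)) ^ Module.finrank ℝ E := by gcongr
      _ = _ := by rw [← Real.exp_nat_mul]; congr 1; ring
  rcases le_or_gt (t ^ 2) (1 / 2) with h | h
  · refine ⟨_, _, Real.sqrt_nonneg _, ?_, sector_subset_closedBall_of_sq_le hu h0 h⟩
    rw [Real.sq_sqrt (by linarith)]
    linarith [Real.add_one_le_exp (-t ^ 2)]
  · have ht : 0 < t := by
      rcases h0.eq_or_lt with rfl | h'
      · norm_num at h
      · exact h'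
    refine ⟨_, _, by positivity, ?_, sector_subset_closedBall_of_pos hu ht⟩
    have := inv_four_mul_le_exp_neg h.le (by nlinarith)
    convert this using 1
    field_simp; norm_num

/-- At least half of the unit ball lies on the positive side of any hyperplane through `0`. -/
lemma measure_ball_le_two_mul (u : E) :
    ν (Metric.ball 0 1) ≤ 2 * ν (Metric.ball 0 1 ∩ {x | 0 ≤ inner ℝ u x}) := by
  set H := Metric.ball (0 : E) 1 ∩ {x | 0 ≤ inner ℝ u x}
  have h : Metric.ball (0 : E) 1 ⊆ H ∪ -H := by
    intro x hx
    rcases le_total 0 (inner ℝ u x) with h | h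
    · exact Or.inl ⟨hx, h⟩
    · exact Or.inr ⟨by simpa using hx, by simpa using h⟩
  refine (measure_mono h).trans ((measure_union_le _ _).trans ?_)
  rw [Measure.measure_neg, two_mul]

/-- Points of the unit ball beyond the hyperplane `⟪u, x⟫ = t` satisfy the cone condition. That
region contains the upper half of an ellipsoid centred at `t • u`, with semi-axis `β` along `u` and
`α` across it, whose volume is read off from `det_stretch`. -/
lemma le_measure_sector {u : E} (hu : ‖u‖ = 1) {t : ℝ} (h0 : 0 < t) (h1 : t < 1) :
    ENNReal.ofReal ((1 - t ^ 2) ^ Module.finrank ℝ E / 12) * ν (Metric.ball 0 1)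
      ≤ ν (sector u t) := by
  have hne : Nontrivial E := ⟨⟨u, 0, by rintro rfl; simp at hu⟩⟩
  have hd : 1 ≤ Module.finrank ℝ E := Module.finrank_pos
  have hd' : (0 : ℝ) < Module.finrank ℝ E := by exact_mod_cast hd
  set d := Module.finrank ℝ E
  set q := 1 - t ^ 2 with hq
  have hq0 : 0 < q := by nlinarith
  have hq1 : q < 1 := by nlinarith
  -- This value maximises `γ ^ d * (1 - γ)`, the main factor in the squared determinant.
  set γ : ℝ := (d : ℝ) / (d + 1) with hγ
  have hγ0 : 0 < γ := by positivity
  have hγ1 : γ < 1 := by rw [hγ, div_lt_one (by positivity)]; linarith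
  have hγq : γ * q < 1 := by nlinarith
  -- With `α² = γ q`, the choice `β² = B` makes the slack in `hbd` a quadratic in `y` with zero
  -- discriminant, hence the perfect square in `hc`.
  set B := γ * (1 - γ) * q ^ 2 / (1 - γ * q) with hB
  have hB0 : 0 < B := by
    have : 0 < 1 - γ := by linarith
    have : 0 < 1 - γ * q := by linarith
    positivity
  have hBe : B * (1 - γ * q) = γ * (1 - γ) * q ^ 2 := div_mul_cancel₀ _ (by linarith)
  set α := √(γ * q)
  set β := √B
  have hα : 0 < α := Real.sqrt_pos.2 (by positivity)
  have hβ : 0 < β := Real.sqrt_pos.2 hB0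
  have hα2 : α ^ 2 = γ * q := Real.sq_sqrt (by positivity)
  have hβ2 : β ^ 2 = B := Real.sq_sqrt hB0.le
  set H := Metric.ball (0 : E) 1 ∩ {x | 0 ≤ inner ℝ u x}
  have hsub : (fun x => t • u + x) '' (stretch u α β '' H) ⊆ sector u t := by
    rintro _ ⟨_, ⟨x, ⟨hx, hxu⟩, rfl⟩, rfl⟩
    have hx1 : ‖x‖ < 1 := by simpa using hx
    have hxu' : 0 ≤ inner ℝ u x := hxu
    have hin : inner ℝ u (t • u + stretch u α β x) = t + β * inner ℝ u x := by
      rw [inner_add_right, inner_stretch hu hα.ne', real_inner_smul_right,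
        real_inner_self_eq_norm_sq, hu]
      ring
    have hpos : t ≤ inner ℝ u (t • u + stretch u α β x) := by
      rw [hin]; nlinarith [mul_nonneg hβ.le hxu']
    have hnorm : ‖t • u + stretch u α β x‖ < 1 := by
      refine lt_of_pow_lt_pow_left₀ 2 zero_le_one ?_
      rw [norm_smul_add_stretch_sq hu hα.ne']
      set y : ℝ := inner ℝ u x
      have hxx : ‖x‖ ^ 2 < 1 := by nlinarith [norm_nonneg x]
      have hbd : (t + β * y) ^ 2 + α ^ 2 * (1 - y ^ 2) ≤ 1 := by
        have ht2 : t ^ 2 = 1 - q := by rw [hq]; ring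
        have hp : 0 < (1 - γ) * q := mul_pos (by linarith) hq0
        have hc : (1 - γ) * q * (1 - ((t + β * y) ^ 2 + α ^ 2 * (1 - y ^ 2)))
            = ((1 - γ) * q - t * β * y) ^ 2 := by
          rw [hα2]
          linear_combination (-((1 - γ) * q) - β ^ 2 * y ^ 2) * ht2
            - y ^ 2 * (1 - γ * q) * hβ2 - y ^ 2 * hBe
        exact sub_nonneg.1 (nonneg_of_mul_nonneg_right (hc ▸ sq_nonneg _) hp)
      have : α ^ 2 * ‖x‖ ^ 2 < α ^ 2 := by nlinarith [sq_pos_of_pos hα]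
      nlinarith
    refine ⟨?_, hnorm, ?_⟩
    · intro (h : t • u + stretch u α β x = 0)
      rw [h, inner_zero_right] at hpos
      linarith
    · nlinarith [norm_nonneg (t • u + stretch u α β x)]
  -- After squaring, the `6` becomes the `36` of `pow_mul_one_sub_mul_le`; halving the ellipsoid
  -- turns it into the final `12`.
  have hdet : q ^ d / 6 ≤ α ^ d * (β / α) := by
    refine le_of_sq_le_sq ?_ (by positivity)
    have e : (α ^ d * (β / α)) ^ 2 = γ ^ d * (1 - γ) * q * q ^ d / (1 - γ * q) := by
      rw [mul_pow, div_pow, ← pow_mul, mul_comm d 2, pow_mul, hα2, hβ2, mul_pow, hB]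
      have : 1 - γ * q ≠ 0 := by linarith
      field_simp
    rw [e, le_div_iff₀ (by linarith)]
    have := pow_mul_one_sub_mul_le d hd hq0.le hq1.le
    have h' : 0 < q ^ d := by positivity
    nlinarith [mul_le_mul_of_nonneg_right this h'.le]
  calc ENNReal.ofReal (q ^ d / 12) * ν (Metric.ball 0 1)
      ≤ ENNReal.ofReal (q ^ d / 12) * (2 * ν H) := by
        gcongr; exact measure_ball_le_two_mul ν u
    _ = ENNReal.ofReal (q ^ d / 6) * ν H := by
        rw [← mul_assoc]
        congr 1
        rw [← ENNReal.ofReal_ofNat 2, ← ENNReal.ofReal_mul (by positivity)]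
        congr 1; ring
    _ ≤ ENNReal.ofReal |LinearMap.det (stretch u α β)| * ν H := by
        gcongr
        rw [det_stretch hu hα.ne']
        exact hdet.trans (le_abs_self _)
    _ = ν ((fun x => t • u + x) '' (stretch u α β '' H)) := by
        rw [← Measure.addHaar_image_linearMap, Set.image_add_left, measure_preimage_add]
    _ ≤ ν (sector u t) := measure_mono hsub

end Sector

/-! ### From caps on spheres to the two robustness measures. -/

section Sphere

variable {d : ℕ}

open scoped Pointwise in
/-- Polar coordinates: the uniform measure of `S` on the sphere of radius `η` is the proportion
of the unit ball that projects radially into `S`. -/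
lemma uniformSphere_apply (hd : 1 ≤ d) (η : ℝ≥0) {S : Set (EuclideanSpace ℝ (Fin d))}
    (hS : MeasurableSet S) :
    uniformSphere d η S
      = volume {y : EuclideanSpace ℝ (Fin d) | y ≠ 0 ∧ ‖y‖ < 1 ∧ ((η : ℝ) / ‖y‖) • y ∈ S}
        / volume (Metric.ball (0 : EuclideanSpace ℝ (Fin d)) 1) := by
  have hm : Measurable (fun n : Metric.sphere (0 : EuclideanSpace ℝ (Fin d)) 1 =>
      (η : ℝ) • (n : EuclideanSpace ℝ (Fin d))) := by fun_prop
  rw [uniformSphere, Measure.map_apply hm hS, Measure.smul_apply, smul_eq_mul,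
    Measure.toSphere_apply' _ (hm hS), Measure.toSphere_apply_univ]
  have hset : Set.Ioo (0 : ℝ) 1 • (Subtype.val ''
      ((fun n : Metric.sphere (0 : EuclideanSpace ℝ (Fin d)) 1 =>
        (η : ℝ) • (n : EuclideanSpace ℝ (Fin d))) ⁻¹' S))
      = {y : EuclideanSpace ℝ (Fin d) | y ≠ 0 ∧ ‖y‖ < 1 ∧ ((η : ℝ) / ‖y‖) • y ∈ S} := by
    ext y
    rw [Set.mem_smul]
    constructor
    · rintro ⟨r, ⟨hr0, hr1⟩, _, ⟨n, hn, rfl⟩, rfl⟩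
      have hn1 : ‖(n : EuclideanSpace ℝ (Fin d))‖ = 1 := by simp
      have hnr : ‖r • (n : EuclideanSpace ℝ (Fin d))‖ = r := by
        rw [norm_smul, hn1, mul_one, Real.norm_of_nonneg hr0.le]
      refine ⟨?_, ?_, ?_⟩
      · rw [← norm_pos_iff, hnr]; exact hr0
      · rw [hnr]; exact hr1
      · rw [hnr, smul_smul, div_mul_cancel₀ _ hr0.ne']; exact hn
    · rintro ⟨h0, h1, h2⟩
      have hpos := norm_pos_iff.2 h0
      refine ⟨‖y‖, ⟨hpos, h1⟩, ‖y‖⁻¹ • y, ⟨⟨‖y‖⁻¹ • y, ?_⟩, ?_, rfl⟩, ?_⟩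
      · simp [norm_smul, hpos.ne']
      · rw [Set.mem_preimage, smul_smul, ← div_eq_mul_inv]; exact h2
      · rw [smul_smul, mul_inv_cancel₀ hpos.ne', one_smul]
  rw [hset, finrank_euclideanSpace_fin]
  have hd0 : (d : ℝ≥0∞) ≠ 0 := by simp; omega
  rw [ENNReal.mul_inv (Or.inl hd0) (Or.inl (by simp)), mul_comm ((d : ℝ≥0∞)⁻¹), mul_assoc,
    ← mul_assoc ((d : ℝ≥0∞)⁻¹), ENNReal.inv_mul_cancel hd0 (by simp), one_mul, mul_comm,
    div_eq_mul_inv]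

lemma uniformSphere_univ (hd : 1 ≤ d) (η : ℝ≥0) : uniformSphere d η Set.univ = 1 := by
  have hm : Measurable (fun n : Metric.sphere (0 : EuclideanSpace ℝ (Fin d)) 1 =>
      (η : ℝ) • (n : EuclideanSpace ℝ (Fin d))) := by fun_prop
  have : Nontrivial (EuclideanSpace ℝ (Fin d)) := by
    have : Nonempty (Fin d) := ⟨⟨0, hd⟩⟩
    infer_instance
  rw [uniformSphere, Measure.map_apply hm .univ, Set.preimage_univ, Measure.smul_apply, smul_eq_mul]
  exact ENNReal.inv_mul_cancel
    (Measure.measure_univ_ne_zero.2 (Measure.toSphere_ne_zero _)) (measure_ne_top _ _)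

variable (w : EuclideanSpace ℝ (Fin d)) (b : ℝ)

lemma continuous_linearClassifier : Continuous (linearClassifier w b) := by
  unfold linearClassifier; fun_prop

lemma linearClassifier_add (x n : EuclideanSpace ℝ (Fin d)) :
    linearClassifier w b (x + n) = linearClassifier w b x + inner ℝ w n := by
  simp only [linearClassifier, inner_add_right]; ring

variable {w}

/-- The perturbations changing the decision at `x` form the spherical cap in the direction of
`-sign (f x) w` at relative height `|f x| / (‖w‖ η)`. -/
lemma uniformSphere_flip (hd : 1 ≤ d) (hw : w ≠ 0) {x : EuclideanSpace ℝ (Fin d)} {s : ℝ}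
    (hs : s ^ 2 = 1) (hsx : 0 < s * linearClassifier w b x) {η : ℝ≥0} (hη : 0 < η) :
    uniformSphere d η {n | linearClassifier w b x * linearClassifier w b (x + n) ≤ 0}
      = volume (sector ((-(s / ‖w‖)) • w) (s * linearClassifier w b x / ‖w‖ / η))
        / volume (Metric.ball (0 : EuclideanSpace ℝ (Fin d)) 1) := by
  have hS : MeasurableSet {n | linearClassifier w b x * linearClassifier w b (x + n) ≤ 0} := by
    refine (isClosed_le ?_ continuous_const).measurableSet
    have := continuous_linearClassifier w b
    fun_prop
  rw [uniformSphere_apply hd η hS]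
  congr 2
  ext y
  refine and_congr_right fun h0 => and_congr_right fun _ => ?_
  have hy := norm_pos_iff.2 h0
  have hw' := norm_pos_iff.2 hw
  have hη' : (0 : ℝ) < η := hη
  rw [Set.mem_ofPred_eq, linearClassifier_add, real_inner_smul_right, real_inner_smul_left]
  set F := linearClassifier w b x
  set I : ℝ := inner ℝ w y
  -- The prefactor `s F η / ‖y‖` is positive, so the flip condition becomes a linear inequality in
  -- `I`.
  have e1 : F * (F + η / ‖y‖ * I) = (s * F) * (η / ‖y‖) * (s * F * ‖y‖ / η + s * I) := by
    field_simp
    linear_combination (-(F * (F * ‖y‖ + η * I))) * hs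
  have e2 : -(s / ‖w‖) * I - s * F / ‖w‖ / η * ‖y‖ = -((s * F * ‖y‖ / η + s * I) / ‖w‖) := by
    field_simp
    ring
  rw [e1, ← sub_nonneg (b := s * F / ‖w‖ / η * ‖y‖), e2, neg_nonneg, div_le_iff₀ hw', zero_mul]
  have hc : 0 < s * F * (η / ‖y‖) := by positivity
  constructor
  · intro h; exact nonpos_of_mul_nonpos_right h hc
  · intro h; exact mul_nonpos_of_nonneg_of_nonpos hc.le h

lemma deltaAdv_eq (hw : w ≠ 0) (x : EuclideanSpace ℝ (Fin d)) :
    deltaAdv (linearClassifier w b) x = ENNReal.ofReal (|linearClassifier w b x| / ‖w‖) := by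
  have hw' := norm_pos_iff.2 hw
  set F := linearClassifier w b x with hF
  apply le_antisymm
  · have hr : inner ℝ w (-(F / ‖w‖ ^ 2) • w) = -F := by
      rw [real_inner_smul_right, real_inner_self_eq_norm_sq]; field_simp
    refine (iInf₂_le (-(F / ‖w‖ ^ 2) • w) ?_).trans ?_
    · rw [linearClassifier_add, hr]; simp [← hF]
    · rw [← ofReal_norm, norm_smul, norm_neg, norm_div, norm_pow, norm_norm, Real.norm_eq_abs]
      refine ENNReal.ofReal_le_ofReal (le_of_eq ?_)
      field_simp
  · refine le_iInf₂ fun r hr => ?_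
    rw [← ofReal_norm]
    refine ENNReal.ofReal_le_ofReal ?_
    rw [linearClassifier_add, ← hF] at hr
    rw [div_le_iff₀ hw', mul_comm]
    refine le_trans ?_ (abs_real_inner_le_norm w r)
    refine le_of_not_gt fun h => ?_
    have h1 : F * inner ℝ w r ≥ -(|F| * |inner ℝ w r|) := by
      rw [← abs_mul]; exact neg_abs_le _
    have h2 : F ^ 2 = |F| ^ 2 := (sq_abs F).symm
    have h3 := abs_nonneg (inner ℝ w r : ℝ)
    nlinarith

lemma deltaAdv_of_eq_zero {f : EuclideanSpace ℝ (Fin d) → ℝ} {x : EuclideanSpace ℝ (Fin d)}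
    (hx : f x = 0) : deltaAdv f x = 0 :=
  le_antisymm ((iInf₂_le 0 (by simp [hx])).trans (by simp)) zero_le

lemma deltaUnif_of_eq_zero (hd : 1 ≤ d) {ε : ℝ} (hε : ε < 1) {f : EuclideanSpace ℝ (Fin d) → ℝ}
    {x : EuclideanSpace ℝ (Fin d)} (hx : f x = 0) : deltaUnif ε f x = 0 := by
  refine le_antisymm (iSup₂_le fun η h => ?_) zero_le
  have e : {n | f x * f (x + n) ≤ 0} = Set.univ := by ext; simp [hx]
  rw [e, uniformSphere_univ hd, ENNReal.one_le_ofReal] at h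
  linarith

lemma deltaAdv_zero_left (hb : b ≠ 0) (x : EuclideanSpace ℝ (Fin d)) :
    deltaAdv (linearClassifier 0 b) x = ⊤ := by
  refine top_le_iff.1 (le_iInf₂ fun r hr => ?_)
  simp only [linearClassifier, inner_zero_left, zero_add] at hr
  exact absurd hr (not_le.2 (mul_self_pos.2 hb))

lemma deltaUnif_zero_left (ε : ℝ) (hb : b ≠ 0) (x : EuclideanSpace ℝ (Fin d)) :
    deltaUnif ε (linearClassifier 0 b) x = ⊤ := by
  refine top_le_iff.1 (ENNReal.le_of_forall_nnreal_lt fun η _ => ?_)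
  refine le_iSup₂_of_le η ?_ le_rfl
  have e : {n : EuclideanSpace ℝ (Fin d) |
      linearClassifier 0 b x * linearClassifier 0 b (x + n) ≤ 0} = ∅ := by
    ext n
    simpa [linearClassifier] using mul_self_pos.2 hb
  rw [e, measure_empty]
  exact zero_le

/-- The largest radius `η` for which the cap in direction `u` cut off at distance `c` from the
centre of the sphere of radius `η` has uniform measure at most `ε`. -/
noncomputable def capRadius (ε : ℝ) (u : EuclideanSpace ℝ (Fin d)) (c : ℝ) : ℝ≥0∞ :=
  ⨆ (η : ℝ≥0) (_ : volume (sector u (c / η)) ≤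
    ENNReal.ofReal ε * volume (Metric.ball (0 : EuclideanSpace ℝ (Fin d)) 1)), (η : ℝ≥0∞)

lemma capRadius_mono (ε : ℝ) (u : EuclideanSpace ℝ (Fin d)) : Monotone (capRadius ε u) := by
  intro c c' hc
  refine iSup_mono fun η => iSup_const_mono fun h => (measure_mono ?_).trans h
  exact sector_antitone u (by gcongr)

lemma deltaUnif_eq_capRadius (hd : 1 ≤ d) (ε : ℝ) (hw : w ≠ 0) {x : EuclideanSpace ℝ (Fin d)}
    {s : ℝ} (hs : s ^ 2 = 1) (hsx : 0 < s * linearClassifier w b x) :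
    deltaUnif ε (linearClassifier w b) x
      = capRadius ε ((-(s / ‖w‖)) • w) (s * linearClassifier w b x / ‖w‖) := by
  unfold deltaUnif capRadius
  congr 1
  ext1 η
  -- The radius `0` contributes `0` to both suprema, whether or not it qualifies.
  rcases eq_zero_or_pos η with rfl | hη
  · simp
  · rw [uniformSphere_flip b hd hw hs hsx hη, ENNReal.div_le_iff
      (Metric.measure_ball_pos _ _ one_pos).ne' measure_ball_lt_top.ne]

lemma le_capRadius (ε : ℝ) {u : EuclideanSpace ℝ (Fin d)} (hu : ‖u‖ = 1) {c : ℝ} :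
    ENNReal.ofReal c ≤ capRadius ε u c := by
  refine ENNReal.le_of_forall_nnreal_lt fun η hη => ?_
  rcases eq_zero_or_pos η with rfl | hη0
  · simp
  refine le_iSup₂_of_le η ?_ le_rfl
  have hη0' : (0 : ℝ) < η := hη0
  have : (η : ℝ) < c := by
    rw [← ENNReal.ofReal_coe_nnreal, ENNReal.ofReal_lt_ofReal_iff'] at hη
    exact hη.1
  rw [sector_eq_empty hu ((one_lt_div hη0').2 this), measure_empty]
  exact zero_le

lemma C₁_mul_le_capRadius {ε : ℝ} (hε₀ : 0 ≤ ε) (hε₁ : ε < 1)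
    {u : EuclideanSpace ℝ (Fin d)} (hu : ‖u‖ = 1) {c : ℝ} (hc : 0 < c) :
    ENNReal.ofReal (C₁ ε * √d * c) ≤ capRadius ε u c := by
  -- The exponential bound needs height `1 / k ≤ 1`; otherwise `le_capRadius` suffices. The first
  -- case also absorbs `ε = 0`, where `C₁ = 0`.
  rcases le_or_gt (C₁ ε * √d) 1 with h1 | h1
  · refine le_trans (ENNReal.ofReal_le_ofReal ?_) (le_capRadius ε hu)
    nlinarith
  have hε : ε ≠ 0 := by
    rintro rfl
    simp [C₁] at h1
    linarith
  have hε' : 0 < ε := lt_of_le_of_ne hε₀ (Ne.symm hε)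
  set ℓ := Real.log (2 / ε) with hℓ
  have hℓ0 : 0 < ℓ := Real.log_pos (by rw [lt_div_iff₀ hε']; linarith)
  have hC : C₁ ε = 1 / √(2 * ℓ) := by
    rw [C₁, if_neg hε, Real.rpow_neg (by positivity), ← Real.sqrt_eq_rpow, one_div]
  have hd : (0 : ℝ) < d := by
    rcases Nat.eq_zero_or_pos d with rfl | h
    · simp at h1; linarith
    · exact_mod_cast h
  set k := C₁ ε * √d with hk
  have hk2 : (1 / k) ^ 2 = 2 * ℓ / d := by
    rw [hk, hC, div_pow, mul_pow, div_pow, Real.sq_sqrt (by positivity), Real.sq_sqrt (by positivity)]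
    field_simp
  have hkc : 0 ≤ k * c := by positivity
  refine le_iSup₂_of_le (k * c).toNNReal ?_ le_rfl
  have e : c / ((k * c).toNNReal : ℝ) = 1 / k := by
    rw [Real.coe_toNNReal _ hkc]; field_simp
  rw [e]
  refine (measure_sector_le volume hu (by positivity) ?_).trans ?_
  · rw [div_le_one (by linarith)]; exact h1.le
  · gcongr
    rw [hk2, finrank_euclideanSpace_fin]
    -- The exponential is then `ε / 2`, which leaves a factor of two to spare.
    have : -(d * (2 * ℓ / d) / 2) = -ℓ := by field_simp
    rw [this, Real.exp_neg, hℓ, Real.exp_log (by positivity), inv_div]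
    linarith

lemma C₂tilde_base_pos (hd : 1 ≤ d) {ε : ℝ} (hε₀ : 0 ≤ ε) (hε₁ : ε < 1 / 12) :
    0 < 1 - (12 * ε) ^ (1 / (d : ℝ)) := by
  have hd' : (0 : ℝ) < d := by exact_mod_cast hd
  have := Real.rpow_lt_one (x := 12 * ε) (z := 1 / (d : ℝ)) (by linarith) (by linarith)
    (by positivity)
  linarith

lemma C₂tilde_eq (hd : 1 ≤ d) {ε : ℝ} (hε₀ : 0 ≤ ε) (hε₁ : ε < 1 / 12) :
    C₂tilde ε d = 1 / √(1 - (12 * ε) ^ (1 / (d : ℝ))) := by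
  rw [C₂tilde, Real.rpow_neg (C₂tilde_base_pos hd hε₀ hε₁).le, ← Real.sqrt_eq_rpow,
    ← one_div (√_)]

lemma capRadius_le (hd : 1 ≤ d) {ε : ℝ} (hε₀ : 0 ≤ ε) (hε₁ : ε < 1 / 12)
    {u : EuclideanSpace ℝ (Fin d)} (hu : ‖u‖ = 1) {c : ℝ} (hc : 0 < c) :
    capRadius ε u c ≤ ENNReal.ofReal (C₂tilde ε d * c) := by
  refine iSup₂_le fun η hη => ?_
  rw [← ENNReal.ofReal_coe_nnreal]
  refine ENNReal.ofReal_le_ofReal (le_of_not_gt fun hlt => ?_)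
  have hB := C₂tilde_base_pos hd hε₀ hε₁
  rw [C₂tilde_eq hd hε₀ hε₁] at hlt
  set A := (12 * ε) ^ (1 / (d : ℝ)) with hA
  have hA0 : 0 ≤ A := Real.rpow_nonneg (by linarith) _
  have hAd : A ^ d = 12 * ε := by
    rw [hA, one_div, Real.rpow_inv_natCast_pow (by linarith) (by omega)]
  have hsq : 0 < √(1 - A) := Real.sqrt_pos.2 hB
  have hη0 : (0 : ℝ) < η := lt_trans (by positivity) hlt
  have ht : c / η < √(1 - A) := by
    rw [div_lt_iff₀ hη0]
    rw [div_mul_eq_mul_div, one_mul, div_lt_iff₀ hsq] at hlt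
    linarith
  have ht0 : 0 < c / η := by positivity
  have ht2 : (c / η) ^ 2 < 1 - A := by
    rw [← Real.sq_sqrt hB.le]; gcongr
  have ht1 : c / η < 1 := by nlinarith
  have h := (le_measure_sector volume hu ht0 ht1).trans hη
  rw [ENNReal.mul_le_mul_iff_left (Metric.measure_ball_pos _ _ one_pos).ne'
    measure_ball_lt_top.ne, ENNReal.ofReal_le_ofReal_iff hε₀, finrank_euclideanSpace_fin] at h
  -- A radius above `C₂tilde ε d * c` gives a sector of share greater than `A ^ d / 12 = ε`.
  have : A ^ d < (1 - (c / η) ^ 2) ^ d := pow_lt_pow_left₀ (by linarith) hA0 (by omega)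
  linarith

lemma C₂tilde_le (hd : 1 ≤ d) {ε : ℝ} (hε₀ : 0 ≤ ε) (hε₁ : ε < 1 / 12) :
    C₂tilde ε d ≤ C₂ ε * √d := by
  have hd' : (0 : ℝ) < d := by exact_mod_cast hd
  have hB := C₂tilde_base_pos hd hε₀ hε₁
  have h1 : 0 < 1 - 12 * ε := by linarith
  have hC : C₂ ε = 1 / √(1 - 12 * ε) := by
    rw [C₂, Real.rpow_neg h1.le, ← Real.sqrt_eq_rpow, one_div]
  rw [C₂tilde_eq hd hε₀ hε₁, hC, div_mul_eq_mul_div, one_mul,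
    div_le_div_iff₀ (Real.sqrt_pos.2 hB) (Real.sqrt_pos.2 h1), one_mul,
    ← Real.sqrt_mul hd'.le]
  refine Real.sqrt_le_sqrt ?_
  set A := (12 * ε) ^ (1 / (d : ℝ)) with hA
  have hA0 : 0 ≤ A := Real.rpow_nonneg (by linarith) _
  have hAd : A ^ d = 12 * ε := by
    rw [hA, one_div, Real.rpow_inv_natCast_pow (by linarith) (by omega)]
  have := one_add_mul_le_pow (a := A - 1) (by linarith) d
  rw [add_sub_cancel, hAd] at this
  linarith

variable (w)

lemma exists_sign {F : ℝ} (hF : F ≠ 0) : ∃ s : ℝ, s ^ 2 = 1 ∧ 0 < s * F ∧ s * F = |F| := by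
  rcases lt_or_gt_of_ne hF with h | h
  · exact ⟨-1, by norm_num, by linarith, by rw [abs_of_neg h]; ring⟩
  · exact ⟨1, by norm_num, by linarith, by rw [abs_of_pos h]; ring⟩

lemma norm_direction {w : EuclideanSpace ℝ (Fin d)} (hw : w ≠ 0) {s : ℝ} (hs : s ^ 2 = 1) :
    ‖(-(s / ‖w‖)) • w‖ = 1 := by
  have hw' := norm_pos_iff.2 hw
  have : |s| = 1 := by rcases sq_eq_one_iff.1 hs with rfl | rfl <;> simp
  rw [norm_smul, norm_neg, norm_div, norm_norm, Real.norm_eq_abs, this]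
  field_simp

/-- The pointwise form of the comparison of the two robustness measures. -/
lemma deltaUnif_bounds (hd : 1 ≤ d) {ε : ℝ} (hε₀ : 0 ≤ ε) (hε₁ : ε < 1 / 12)
    (x : EuclideanSpace ℝ (Fin d)) :
    ENNReal.ofReal (max (C₁ ε * √d) 1) * deltaAdv (linearClassifier w b) x
        ≤ deltaUnif ε (linearClassifier w b) x ∧
      deltaUnif ε (linearClassifier w b) x
        ≤ ENNReal.ofReal (C₂tilde ε d) * deltaAdv (linearClassifier w b) x := by
  have hC : 0 < C₂tilde ε d := Real.rpow_pos_of_pos (C₂tilde_base_pos hd hε₀ hε₁) _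
  rcases eq_or_ne (linearClassifier w b x) 0 with hx | hx
  · simp [deltaAdv_of_eq_zero hx, deltaUnif_of_eq_zero hd (by linarith : ε < 1) hx]
  rcases eq_or_ne w 0 with rfl | hw
  · have hb : b ≠ 0 := by simpa [linearClassifier] using hx
    rw [deltaAdv_zero_left b hb, deltaUnif_zero_left b ε hb]
    exact ⟨le_top, by rw [ENNReal.mul_top (by simpa using hC)]⟩
  obtain ⟨s, hs, hsx, hsa⟩ := exists_sign hx
  have hu := norm_direction hw hs
  have hw' := norm_pos_iff.2 hw
  rw [deltaUnif_eq_capRadius b hd ε hw hs hsx, deltaAdv_eq b hw, hsa]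
  have hc : 0 < |linearClassifier w b x| / ‖w‖ := by positivity
  constructor
  · rw [← ENNReal.ofReal_mul (by positivity), max_mul_of_nonneg _ _ hc.le, one_mul,
      ENNReal.ofReal_max]
    exact max_le (C₁_mul_le_capRadius hε₀ (by linarith) hu hc) (le_capRadius ε hu)
  · rw [← ENNReal.ofReal_mul hC.le]
    exact capRadius_le hd hε₀ hε₁ hu hc

lemma measurable_deltaAdv : Measurable (deltaAdv (linearClassifier w b)) := by
  rcases eq_or_ne w 0 with rfl | hw
  · have : deltaAdv (linearClassifier (0 : EuclideanSpace ℝ (Fin d)) b)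
        = fun _ => deltaAdv (linearClassifier (0 : EuclideanSpace ℝ (Fin d)) b) 0 := by
      ext x; simp [deltaAdv, linearClassifier]
    rw [this]; exact measurable_const
  · rw [funext (deltaAdv_eq b hw)]
    have := (continuous_linearClassifier w b).measurable
    fun_prop

lemma measurable_deltaUnif (hd : 1 ≤ d) {ε : ℝ} (hε : ε < 1) :
    Measurable (deltaUnif ε (linearClassifier w b)) := by
  rcases eq_or_ne w 0 with rfl | hw
  · have : deltaUnif ε (linearClassifier (0 : EuclideanSpace ℝ (Fin d)) b)
        = fun _ => deltaUnif ε (linearClassifier (0 : EuclideanSpace ℝ (Fin d)) b) 0 := by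
      ext x; simp [deltaUnif, linearClassifier]
    rw [this]; exact measurable_const
  · have hf := (continuous_linearClassifier w b).measurable
    -- On each side of the hyperplane the cap direction is fixed, so `deltaUnif` is a monotone
    -- function of a continuous one.
    have e : deltaUnif ε (linearClassifier w b) = fun x =>
        if 0 < linearClassifier w b x then
          capRadius ε ((-(1 / ‖w‖)) • w) (1 * linearClassifier w b x / ‖w‖)
        else if linearClassifier w b x < 0 then
          capRadius ε ((-((-1) / ‖w‖)) • w) ((-1) * linearClassifier w b x / ‖w‖)
        else 0 := by
      ext1 x
      split_ifs with h1 h2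
      · exact deltaUnif_eq_capRadius b hd ε hw (by norm_num) (by linarith)
      · exact deltaUnif_eq_capRadius b hd ε hw (by norm_num) (by linarith)
      · exact deltaUnif_of_eq_zero hd hε (le_antisymm (not_lt.1 h1) (not_lt.1 h2))
    rw [e]
    refine Measurable.ite (measurableSet_lt measurable_const hf) ?_
      (Measurable.ite (measurableSet_lt hf measurable_const) ?_ measurable_const)
    · exact (capRadius_mono _ _).measurable.comp (by fun_prop)
    · exact (capRadius_mono _ _).measurable.comp (by fun_prop)

lemma rhoAdv_lt_top (μ : Measure (EuclideanSpace ℝ (Fin d))) [IsProbabilityMeasure μ]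
    {w : EuclideanSpace ℝ (Fin d)} (hw : w ≠ 0) {M : ℝ} (hM : ∀ᵐ x ∂μ, ‖x‖ ≤ M) :
    rhoAdv μ (linearClassifier w b) < ⊤ := by
  have hw' := norm_pos_iff.2 hw
  calc rhoAdv μ (linearClassifier w b)
      ≤ ∫⁻ _, ENNReal.ofReal ((‖w‖ * M + |b|) / ‖w‖) ∂μ := by
        refine lintegral_mono_ae (hM.mono fun x hx => ?_)
        rw [deltaAdv_eq b hw]
        gcongr
        refine (abs_add_le _ _).trans ?_
        gcongr
        exact (abs_real_inner_le_norm w x).trans (by gcongr)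
    _ < ⊤ := by simp

end Sphere

end Robustness

theorem theorem2 (d : ℕ) (hd : 1 ≤ d)
    (μ : MeasureTheory.Measure (EuclideanSpace ℝ (Fin d))) [MeasureTheory.IsProbabilityMeasure μ]
    (w : EuclideanSpace ℝ (Fin d)) (b : ℝ) (ε : ℝ) (hε₀ : 0 ≤ ε) (hε₁ : ε < 1 / 12) :
    -- the two expectations are expectations of measurable functions
    Measurable (Robustness.deltaAdv (Robustness.linearClassifier w b)) ∧
    Measurable (Robustness.deltaUnif ε (Robustness.linearClassifier w b)) ∧
    -- they are finite for a nonconstant classifier and data of bounded support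
    (w ≠ 0 → (∃ M : ℝ, ∀ᵐ x ∂μ, ‖x‖ ≤ M) →
      Robustness.rhoAdv μ (Robustness.linearClassifier w b) < ⊤ ∧
      Robustness.rhoUnif μ ε (Robustness.linearClassifier w b) < ⊤) ∧
    -- the bounds
    ENNReal.ofReal (max (Robustness.C₁ ε * √(d : ℝ)) 1) *
        Robustness.rhoAdv μ (Robustness.linearClassifier w b)
      ≤ Robustness.rhoUnif μ ε (Robustness.linearClassifier w b) ∧
    Robustness.rhoUnif μ ε (Robustness.linearClassifier w b)
      ≤ ENNReal.ofReal (Robustness.C₂tilde ε d) *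
        Robustness.rhoAdv μ (Robustness.linearClassifier w b) ∧
    ENNReal.ofReal (Robustness.C₂tilde ε d) *
        Robustness.rhoAdv μ (Robustness.linearClassifier w b)
      ≤ ENNReal.ofReal (Robustness.C₂ ε * √(d : ℝ)) *
        Robustness.rhoAdv μ (Robustness.linearClassifier w b) := by
  have hb := fun x => Robustness.deltaUnif_bounds w b hd hε₀ hε₁ x
  have hmA := Robustness.measurable_deltaAdv w b
  have hmU := Robustness.measurable_deltaUnif w b hd (by linarith : ε < 1)
  have hup : Robustness.rhoUnif μ ε (Robustness.linearClassifier w b)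
      ≤ ENNReal.ofReal (Robustness.C₂tilde ε d) *
        Robustness.rhoAdv μ (Robustness.linearClassifier w b) := by
    rw [Robustness.rhoAdv, ← MeasureTheory.lintegral_const_mul _ hmA]
    exact MeasureTheory.lintegral_mono fun x => (hb x).2
  refine ⟨hmA, hmU, ?_, ?_, hup, ?_⟩
  · rintro hw ⟨M, hM⟩
    have hA := Robustness.rhoAdv_lt_top b μ hw hM
    exact ⟨hA, hup.trans_lt (ENNReal.mul_lt_top ENNReal.ofReal_lt_top hA)⟩
  · rw [Robustness.rhoAdv, ← MeasureTheory.lintegral_const_mul _ hmA]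
    exact MeasureTheory.lintegral_mono fun x => (hb x).1
  · gcongr
    exact Robustness.C₂tilde_le hd hε₀ hε₁
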